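/- **Theorem 1.1.** Let $\mathcal I=\{d_1,\dots,d_l\}$ be block lengths with $N=d_1+\cdots+d_l$, and split each $x\in\mathbb R^N$ into consecutive blocks $x[1],\dots,x[l]$ with $x[i]\in\mathbb R^{d_i}$. Put $\|x\|_{2,\mathcal I}=\sum_{i=1}^l\|x[i]\|_2$, and call $x$ block $k$-sparse if at most $k$ of its blocks are non-zero. For a matrix $\Phi\in\mathbb R^{M\times N}$ and a positive integer $k$, let $\delta_{k|\mathcal I}$ be the smallest constant $\delta\ge 0$ such that $$(1-\delta)\|x\|_2^2\le\|\Phi x\|_2^2\le(1+\delta)\|x\|_2^2\qquad\text{for all block } k\text{-sparse } x\in\mathbb R^N,$$ and for real $\theta>0$ put $\delta_{\theta|\mathcal I}=\delta_{\lceil\theta\rceil|\mathcal I}$. Let $x_{\max(s)}$ be obtained from $x$ by setting to zero all blocks except the $s$ blocks of largest Euclidean norm (ties broken arbitrarily; $x_{\max(s)}=x$ if $s\ge l$), and let $x_{-\max(s)}=x-x_{\max(s)}$. Let $s$ be a positive integer and $t$ a real number with $0<t<4/3$ and $ts\ge2$, and suppose that $\delta:=\delta_{ts|\mathcal I}<\dfrac{t}{4-t}$.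 Let $x\in\mathbb R^N$ be arbitrary and let $b=\Phi x+\xi$ with $\|\xi\|_2\le\rho$. Then every solution $x^*$ of $$\min_{z\in\mathbb R^N}\|z\|_{2,\mathcal I}\quad\text{subject to}\quad\|\Phi z-b\|_2\le\rho$$ satisfies $$\|x^*-x\|_2\le\frac{2\sqrt2\,\rho\sqrt{1+\delta}}{t+(t-4)\delta}\max\{\sqrt t,t\}+\frac12\sqrt{\frac2s}\left(\frac{8\delta+4\sqrt{(t+(t-4)\delta)\,\delta}}{t+(t-4)\delta}+1\right)\|x_{-\max(s)}\|_{2,\mathcal I}.$$ -/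

import Mathlib

namespace BlockSparse

noncomputable section

/-- The signal space `ℝ^N`, `N = d 0 + ⋯ + d (l - 1)`, with the Euclidean norm. A coordinate is
labelled by the pair (block index `i`, position inside the `i`-th block of length `d i`). -/
abbrev Signal {l : ℕ} (d : Fin l → ℕ) : Type := EuclideanSpace ℝ (Σ i : Fin l, Fin (d i))

/-- The `i`-th block `x[i]` of `x`. -/
def block {l : ℕ} {d : Fin l → ℕ} (x : Signal d) (i : Fin l) : EuclideanSpace ℝ (Fin (d i)) :=
  WithLp.toLp 2 fun j => x ⟨i, j⟩

/-- The mixed norm `‖x‖_{2,I} = ∑ i, ‖x[i]‖₂`. -/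
def mixedNorm {l : ℕ} {d : Fin l → ℕ} (x : Signal d) : ℝ := ∑ i, ‖block x i‖

open Classical in
/-- The block support: the set of indices of the non-zero blocks. -/
def blockSupport {l : ℕ} {d : Fin l → ℕ} (x : Signal d) : Finset (Fin l) :=
  Finset.univ.filter fun i => block x i ≠ 0

/-- `x` is block `k`-sparse: at most `k` of its blocks are non-zero. -/
def IsBlockSparse {l : ℕ} {d : Fin l → ℕ} (k : ℕ) (x : Signal d) : Prop :=
  (blockSupport x).card ≤ k

/-- The matrix-vector product `Φ x`, as a vector of the Euclidean space `ℝ^M`. -/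
def apply {l M : ℕ} {d : Fin l → ℕ} (Φ : Matrix (Fin M) (Σ i : Fin l, Fin (d i)) ℝ)
    (x : Signal d) : EuclideanSpace ℝ (Fin M) :=
  WithLp.toLp 2 (Φ.mulVec (WithLp.ofLp x))

/-- `Φ` satisfies the block restricted isometry property of order `k` with constant `δ`. -/
def BlockRIP {l M : ℕ} {d : Fin l → ℕ} (Φ : Matrix (Fin M) (Σ i : Fin l, Fin (d i)) ℝ)
    (k : ℕ) (δ : ℝ) : Prop :=
  ∀ x : Signal d, IsBlockSparse k x →
    (1 - δ) * ‖x‖ ^ 2 ≤ ‖apply Φ x‖ ^ 2 ∧ ‖apply Φ x‖ ^ 2 ≤ (1 + δ) * ‖x‖ ^ 2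

/-- The block restricted isometry constant of real order `θ`: the smallest nonnegative constant with
which `Φ` satisfies the block restricted isometry property of order `⌈θ⌉`. -/
def blockRIC {l M : ℕ} {d : Fin l → ℕ} (Φ : Matrix (Fin M) (Σ i : Fin l, Fin (d i)) ℝ)
    (θ : ℝ) : ℝ :=
  sInf {δ : ℝ | 0 ≤ δ ∧ BlockRIP Φ ⌈θ⌉₊ δ}

/-- The infimum in the definition of `blockRIC` is a minimum. -/
theorem isLeast_blockRIC {l M : ℕ} {d : Fin l → ℕ}
    (Φ : Matrix (Fin M) (Σ i : Fin l, Fin (d i)) ℝ) (θ : ℝ) :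
    IsLeast {δ : ℝ | 0 ≤ δ ∧ BlockRIP Φ ⌈θ⌉₊ δ} (blockRIC Φ θ) := by
  have hbdd : BddBelow {δ : ℝ | 0 ≤ δ ∧ BlockRIP Φ ⌈θ⌉₊ δ} := ⟨0, fun δ h => h.1⟩
  have hclosed : IsClosed {δ : ℝ | 0 ≤ δ ∧ BlockRIP Φ ⌈θ⌉₊ δ} := by
    simp only [BlockRIP, Set.setOf_and, Set.setOf_forall]
    refine (isClosed_le continuous_const continuous_id).inter ?_
    refine isClosed_iInter fun x => isClosed_iInter fun _ => ?_
    exact (isClosed_le (by fun_prop) (by fun_prop)).inter (isClosed_le (by fun_prop) (by fun_prop))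
  have hne : {δ : ℝ | 0 ≤ δ ∧ BlockRIP Φ ⌈θ⌉₊ δ}.Nonempty := by
    set L := (Matrix.toEuclideanLin Φ).toContinuousLinearMap with hL
    have key : ∀ x : Signal d, ‖apply Φ x‖ ≤ ‖L‖ * ‖x‖ := fun x => L.le_opNorm x
    refine ⟨1 + ‖L‖ ^ 2, by positivity, fun x _ => ⟨?_, ?_⟩⟩
    · nlinarith [sq_nonneg ‖apply Φ x‖, mul_nonneg (sq_nonneg ‖L‖) (sq_nonneg ‖x‖)]
    · have h := pow_le_pow_left₀ (norm_nonneg _) (key x) 2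
      nlinarith [sq_nonneg ‖x‖]
  exact hclosed.isLeast_csInf hne hbdd

/-- The vector `x_S` that keeps the blocks of `x` with index in `S` and is zero elsewhere. -/
def restrictBlocks {l : ℕ} {d : Fin l → ℕ} (S : Finset (Fin l)) (x : Signal d) : Signal d :=
  WithLp.toLp 2 fun p => if p.1 ∈ S then x p else 0

/-- `S` is a set of indices of the `s` largest blocks of `x` in Euclidean norm (of all blocks, if
there are at most `s`); ties may be broken in any way. -/
def IsLargestBlocks {l : ℕ} {d : Fin l → ℕ} (s : ℕ) (x : Signal d) (S : Finset (Fin l)) : Prop :=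
  S.card = min s l ∧ ∀ i ∈ S, ∀ j ∉ S, ‖block x j‖ ≤ ‖block x i‖

/-- A set of `s` largest blocks always exists. -/
theorem exists_isLargestBlocks {l : ℕ} {d : Fin l → ℕ} (s : ℕ) (x : Signal d) :
    ∃ S : Finset (Fin l), IsLargestBlocks s x S := by
  unfold IsLargestBlocks
  have hs : min s l ≤ l := min_le_right _ _
  generalize min s l = k at hs
  induction k with
  | zero => exact ⟨∅, by simp⟩
  | succ k ih =>
    obtain ⟨S, hc, hS⟩ := ih (by omega)
    have hne : (Sᶜ).Nonempty := by
      rw [← Finset.card_pos, Finset.card_compl, Fintype.card_fin]; omega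
    obtain ⟨m, hm, hmax⟩ := Finset.exists_max_image Sᶜ (fun i => ‖block x i‖) hne
    rw [Finset.mem_compl] at hm
    refine ⟨insert m S, by rw [Finset.card_insert_of_notMem hm, hc], fun i hi j hj => ?_⟩
    rw [Finset.mem_insert, not_or] at hj
    rcases Finset.mem_insert.1 hi with rfl | hi
    · exact hmax j (Finset.mem_compl.2 hj.2)
    · exact hS i hi j hj.2

/-- `z` solves the program `min ‖x‖_{2,I}` subject to `‖Φ x - b‖₂ ≤ ρ`. -/
def IsSolution {l M : ℕ} {d : Fin l → ℕ} (Φ : Matrix (Fin M) (Σ i : Fin l, Fin (d i)) ℝ)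
    (b : EuclideanSpace ℝ (Fin M)) (ρ : ℝ) (z : Signal d) : Prop :=
  ‖apply Φ z - b‖ ≤ ρ ∧ ∀ y : Signal d, ‖apply Φ y - b‖ ≤ ρ → mixedNorm z ≤ mixedNorm y

end

end BlockSparse

/-! Let h = `xstar - x` have blocks e i, let T index its s largest blocks, let L be the matrix, n =
⌈ts⌉, and ω the mixed norm of the tail of x. Minimality of `xstar` yields the cone condition: the
block norms of h outside T sum to at most those inside plus 2ω. Feasibility yields ‖L h‖ ≤ 2ρ. Each
block outside T has norm at most X/√s with X = ‖h_T‖, so the cone condition gives ‖h‖ ≤ √2 X +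
ω/√(2s), and only X remains to be bounded.

With τ = 2ω/√s the decisive estimate (`RestrictedIsometry.head_inner_bound`) is t(1+δ)X² ≤ t⟨L h_T,
L h⟩ + δ(3X² + (X+τ)²). Cauchy–Schwarz turns it into a quadratic inequality for X with leading
coefficient t + (t-4)δ, which is positive exactly when δ < t/(4-t).

Behind it lies `RestrictedIsometry.key_inequality`. The isometry bounds at h_A + pW and h_A - qW,
weighted by q² and p², combine so that ‖L W‖² cancels and what is left is affine in L W. Sparse W
may then be replaced by a convex combination of sparse vectors, and h outside T is one. As n may be
smaller than |T|, the bounds are averaged over the a-subsets A of T; the terms ‖L (e i)‖² that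
appear are controlled by the isometry property on e i - e j. Combining these inequalities so that ‖L
h_T‖² and the cross term get equal weights gives the estimate. -/

open Finset

/-! ### Convex combinations of sparse vectors -/

/-- A linear functional that is at least `C` on the indicators of all sets with at most `b` elements
is at least `C` on `{y ∈ [0,1]^ι : ∑ y ≤ b}`, the convex hull of these indicators. -/
theorem le_linear_of_le_indicator {ι : Type*} [Fintype ι] [DecidableEq ι] (f : (ι → ℝ) →ₗ[ℝ] ℝ)
    (b : ℕ) (C : ℝ) (hf : ∀ B : Finset ι, B.card ≤ b → C ≤ f (fun i => if i ∈ B then 1 else 0))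
    (y : ι → ℝ) (h0 : ∀ i, 0 ≤ y i) (h1 : ∀ i, y i ≤ 1) (hb : ∑ i, y i ≤ b) : C ≤ f y := by
  -- `y` lies on the segment between `y + r • p` and `y - r' • p`, so one endpoint has a value no
  -- larger than `f y`. The induction on the number of non-integral coordinates moves along `p` in
  -- both directions until some coordinate becomes 0 or 1.
  have move : ∀ (y p : ι → ℝ) (r r' : ℝ), 0 < r → 0 < r' → C ≤ f (y + r • p) →
      C ≤ f (y - r' • p) → C ≤ f y := by
    intro y p r r' hr hr' h h'
    simp only [map_add, map_sub, map_smul, smul_eq_mul] at h h'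
    nlinarith [mul_le_mul_of_nonneg_left h hr'.le, mul_le_mul_of_nonneg_left h' hr.le]
  obtain ⟨k, hk⟩ : ∃ k, (univ.filter fun i => y i ≠ 0 ∧ y i ≠ 1).card ≤ k := ⟨_, le_rfl⟩
  induction k generalizing y with
  | zero =>
    have hy : ∀ i, y i = 0 ∨ y i = 1 := by
      intro i
      have := (filter_eq_empty_iff.1 (card_eq_zero.1 (Nat.le_zero.1 hk))) (mem_univ i)
      tauto
    have hyB : y = fun i => if i ∈ univ.filter (fun i => y i = 1) then 1 else 0 := by
      ext i
      rcases hy i with h | h <;> simp [h]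
    rw [hyB]
    apply hf
    rw [hyB] at hb
    simp only [sum_ite_mem, univ_inter, sum_const, nsmul_eq_mul, mul_one] at hb
    exact_mod_cast hb
  | succ k ih =>
    have reduce : ∀ (z : ι → ℝ) (i : ι), y i ≠ 0 ∧ y i ≠ 1 → (z i = 0 ∨ z i = 1) →
        (∀ j, y j = 0 ∨ y j = 1 → z j = y j) →
        (univ.filter fun i => z i ≠ 0 ∧ z i ≠ 1).card ≤ k := by
      intro z i hi hz hzy
      refine Nat.le_of_lt_succ (lt_of_lt_of_le (card_lt_card ?_) hk)
      refine (ssubset_iff_of_subset ?_).2 ⟨i, by simpa using hi, by simp; tauto⟩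
      intro j hj
      simp only [mem_filter, mem_univ, true_and] at hj ⊢
      by_contra hc
      have := hzy j (by tauto)
      rw [this] at hj
      exact hc hj
    by_cases hne : ∃ i, y i ≠ 0 ∧ y i ≠ 1
    swap
    · push Not at hne
      apply ih y h0 h1 hb
      rw [filter_eq_empty_iff.2 (by simpa using hne)]
      simp
    obtain ⟨i, hi⟩ := hne
    have hi0 : 0 < y i := lt_of_le_of_ne (h0 i) hi.1.symm
    have hi1 : y i < 1 := lt_of_le_of_ne (h1 i) hi.2
    by_cases hj : ∃ j, j ≠ i ∧ y j ≠ 0 ∧ y j ≠ 1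
    -- Two fractional coordinates: shifting mass from one to the other keeps the sum.
    · obtain ⟨j, hji, hj⟩ := hj
      have hj0 : 0 < y j := lt_of_le_of_ne (h0 j) hj.1.symm
      have hj1 : y j < 1 := lt_of_le_of_ne (h1 j) hj.2
      have step : ∀ r : ℝ, 0 ≤ y i + r → y i + r ≤ 1 → 0 ≤ y j - r → y j - r ≤ 1 →
          (y i + r = 0 ∨ y i + r = 1 ∨ y j - r = 0 ∨ y j - r = 1) →
          C ≤ f (y + r • (Pi.single i 1 - Pi.single j 1)) := by
        intro r a1 a2 a3 a4 hr
        have ei : (y + r • (Pi.single i 1 - Pi.single j 1) : ι → ℝ) i = y i + r := by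
          simp [hji.symm]
        have ej : (y + r • (Pi.single i 1 - Pi.single j 1) : ι → ℝ) j = y j - r := by
          simp [hji]; ring
        have eo : ∀ m, m ≠ i → m ≠ j →
            (y + r • (Pi.single i 1 - Pi.single j 1) : ι → ℝ) m = y m := by
          intro m hm hm'
          simp [hm, hm']
        have hkeep : ∀ m, y m = 0 ∨ y m = 1 →
            (y + r • (Pi.single i 1 - Pi.single j 1) : ι → ℝ) m = y m :=
          fun m hm => eo m (by rintro rfl; tauto) (by rintro rfl; tauto)
        apply ih
        · intro m
          by_cases hm : m = i
          · rw [hm, ei]; exact a1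
          by_cases hm' : m = j
          · rw [hm', ej]; exact a3
          rw [eo m hm hm']; exact h0 m
        · intro m
          by_cases hm : m = i
          · rw [hm, ei]; exact a2
          by_cases hm' : m = j
          · rw [hm', ej]; exact a4
          rw [eo m hm hm']; exact h1 m
        · simpa [sum_add_distrib, ← mul_sum, sum_sub_distrib] using hb
        · rcases hr with hr | hr | hr | hr
          · exact reduce _ i hi (by rw [ei]; exact Or.inl hr) hkeep
          · exact reduce _ i hi (by rw [ei]; exact Or.inr hr) hkeep
          · exact reduce _ j hj (by rw [ej]; exact Or.inl hr) hkeep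
          · exact reduce _ j hj (by rw [ej]; exact Or.inr hr) hkeep
      refine move y (Pi.single i 1 - Pi.single j 1) (min (1 - y i) (y j)) (min (y i) (1 - y j))
        (lt_min (by linarith) hj0) (lt_min hi0 (by linarith)) ?_ ?_
      · rcases min_cases (1 - y i) (y j) with ⟨h, h'⟩ | ⟨h, h'⟩ <;> rw [h] <;> apply step <;>
          first | linarith | skip
        · right; left; ring
        · right; right; left; ring
      · rw [sub_eq_add_neg, ← neg_smul]
        rcases min_cases (y i) (1 - y j) with ⟨h, h'⟩ | ⟨h, h'⟩ <;> rw [h] <;> apply step <;>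
          first | linarith | skip
        · left; ring
        · right; right; right; ring
    · push Not at hj
      have hint : ∀ j, j ≠ i → y j = 0 ∨ y j = 1 := fun j hji => by
        by_cases h : y j = 0
        · exact Or.inl h
        · exact Or.inr (hj j hji h)
      have hsum : ∑ j, y j = y i + ((univ.erase i).filter fun j => y j = 1).card := by
        rw [← add_sum_erase _ _ (mem_univ i)]
        congr 1
        rw [card_filter, Nat.cast_sum]
        refine sum_congr rfl fun j hj => ?_
        rcases hint j (ne_of_mem_erase hj) with h | h <;> simp [h]
      -- A single fractional coordinate: the rest of the sum is an integer strictly below `b`, so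
      -- there is room to raise `y i` to 1.
      have hlt : ((univ.erase i).filter fun j => y j = 1).card + 1 ≤ b := by
        have : (((univ.erase i).filter fun j => y j = 1).card : ℝ) < b := by linarith
        exact_mod_cast this
      have hlt' : (((univ.erase i).filter fun j => y j = 1).card : ℝ) + 1 ≤ b := by
        exact_mod_cast hlt
      have step : ∀ r : ℝ, (y i + r = 0 ∨ y i + r = 1) → C ≤ f (y + r • Pi.single i 1) := by
        intro r hr
        have ei : (y + r • Pi.single i 1 : ι → ℝ) i = y i + r := by simp
        have eo : ∀ m, m ≠ i → (y + r • Pi.single i 1 : ι → ℝ) m = y m := by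
          intro m hm
          simp [hm]
        apply ih
        · intro m
          by_cases hm : m = i
          · rw [hm, ei]; rcases hr with h | h <;> rw [h]; simp
          rw [eo m hm]; exact h0 m
        · intro m
          by_cases hm : m = i
          · rw [hm, ei]; rcases hr with h | h <;> rw [h]; simp
          rw [eo m hm]; exact h1 m
        · have : ∑ m, (y + r • Pi.single i 1 : ι → ℝ) m = ∑ m, y m + r := by
            simp [sum_add_distrib, ← mul_sum]
          rw [this, hsum]
          rcases hr with h | h <;> linarith
        · exact reduce _ i hi (by rw [ei]; exact hr)
            fun m hm => eo m (by rintro rfl; tauto)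
      refine move y (Pi.single i 1) (1 - y i) (y i) (by linarith) hi0 (step _ (by simp)) ?_
      rw [sub_eq_add_neg, ← neg_smul]
      exact step _ (by simp)

/-! ### Averages over subsets of fixed size -/

theorem sum_powersetCard_sum {ι : Type*} [DecidableEq ι] (T : Finset ι) {a : ℕ} (ha : 1 ≤ a)
    (f : ι → ℝ) :
    ∑ A ∈ powersetCard a T, ∑ i ∈ A, f i = (T.card - 1).choose (a - 1) * ∑ i ∈ T, f i := by
  have h : ∀ A ∈ powersetCard a T, ∑ i ∈ A, f i = ∑ i ∈ T, if i ∈ A then f i else 0 := by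
    intro A hA
    rw [sum_ite_mem, inter_eq_right.2 (mem_powersetCard.1 hA).1]
  rw [sum_congr rfl h, sum_comm, mul_sum]
  refine sum_congr rfl fun i hi => ?_
  have := card_filter_powersetCard_subset {i} T a (by simpa using hi) (by simpa using ha)
  simp only [singleton_subset_iff, card_singleton] at this
  rw [← sum_filter, sum_const, this, nsmul_eq_mul]

/-- Averages of a quadratic form over the `a`-subsets of `T`. -/
theorem sum_powersetCard_sum_sum {ι : Type*} [DecidableEq ι] (T : Finset ι) {a : ℕ} (ha : 1 ≤ a)
    (haT : a ≤ T.card) (g : ι → ι → ℝ) :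
    ((T.card : ℝ) - 1) * ∑ A ∈ powersetCard a T, ∑ i ∈ A, ∑ j ∈ A, g i j =
      (T.card - 1).choose (a - 1) *
        ((T.card - a) * ∑ i ∈ T, g i i + (a - 1) * ∑ i ∈ T, ∑ j ∈ T, g i j) := by
  have h : ∀ A ∈ powersetCard a T, ∑ i ∈ A, ∑ j ∈ A, g i j =
      ∑ i ∈ T, ∑ j ∈ T, if i ∈ A ∧ j ∈ A then g i j else 0 := by
    intro A hA
    have hAT := (mem_powersetCard.1 hA).1
    simp only [ite_and, sum_ite_irrel, sum_const_zero]
    rw [sum_ite_mem, inter_eq_right.2 hAT]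
    refine sum_congr rfl fun i _ => ?_
    rw [sum_ite_mem, inter_eq_right.2 hAT]
  rw [sum_congr rfl h, sum_comm]
  have hcount : ∀ i ∈ T, ∀ j ∈ T,
      ((T.card : ℝ) - 1) * ∑ A ∈ powersetCard a T, (if i ∈ A ∧ j ∈ A then g i j else 0) =
      (T.card - 1).choose (a - 1) *
        ((if i = j then (T.card - a) * g i j else 0) + (a - 1) * g i j) := by
    intro i hi j hj
    have hsub : ∀ A : Finset ι, (i ∈ A ∧ j ∈ A) ↔ {i, j} ⊆ A := by
      intro A; simp [insert_subset_iff]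
    simp only [hsub]
    rw [← sum_filter, sum_const, nsmul_eq_mul]
    by_cases hij : i = j
    · subst hij
      rw [card_filter_powersetCard_subset _ _ _ (by simpa using hi) (by simpa using ha)]
      simp
      ring
    · have hc : ({i, j} : Finset ι).card = 2 := card_pair hij
      rw [if_neg hij, zero_add]
      -- For `a = 1` no subset contains a pair, and the truncated `a - 2` would miscount. Otherwise
      -- (σ-1)·C(σ-2, a-2) = (a-1)·C(σ-1, a-1) with σ = `T.card`.
      rcases Nat.lt_or_ge a 2 with h2 | h2
      · have : a = 1 := by omega
        subst this
        rw [filter_eq_empty_iff.2]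
        · simp
        · intro A hA hs
          have := card_le_card hs
          rw [hc, (mem_powersetCard.1 hA).2] at this
          omega
      · rw [card_filter_powersetCard_subset _ _ _ (by simp [insert_subset_iff, hi, hj])
          (by rw [hc]; exact h2), hc]
        obtain ⟨m, hm⟩ : ∃ m, T.card = m + 2 := ⟨T.card - 2, by omega⟩
        obtain ⟨k, rfl⟩ : ∃ k, a = k + 2 := ⟨a - 2, by omega⟩
        have := Nat.add_one_mul_choose_eq m k
        have h' : ((m : ℝ) + 1) * m.choose k = (m + 1).choose (k + 1) * (k + 1) := by
          exact_mod_cast this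
        rw [hm]
        simp only [Nat.add_sub_cancel, show m + 2 - 1 = m + 1 from rfl,
          show k + 2 - 1 = k + 1 from rfl]
        push_cast
        linear_combination g i j * h'
  rw [mul_sum]
  have : ∀ i ∈ T, ((T.card : ℝ) - 1) * ∑ A ∈ powersetCard a T, ∑ j ∈ T,
      (if i ∈ A ∧ j ∈ A then g i j else 0) = (T.card - 1).choose (a - 1) *
        ((T.card - a) * g i i + (a - 1) * ∑ j ∈ T, g i j) := by
    intro i hi
    rw [sum_comm, mul_sum, sum_congr rfl (hcount i hi), ← mul_sum, sum_add_distrib, ← mul_sum,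
      sum_ite_eq, if_pos hi]
  rw [sum_congr rfl this, ← mul_sum, sum_add_distrib, ← mul_sum, ← mul_sum]

/-! ### Restricted isometry on orthogonal families -/

section OrthogonalBlocks

variable {ι E F : Type*} [NormedAddCommGroup E] [InnerProductSpace ℝ E]
  [NormedAddCommGroup F] [InnerProductSpace ℝ F]

/-- The restricted isometry property of order `n` of `L` on the span of a family `e`. -/
def RestrictedIsometry (L : E →ₗ[ℝ] F) (e : ι → E) (n : ℕ) (δ : ℝ) : Prop :=
  ∀ (A : Finset ι) (c : ι → ℝ), A.card ≤ n →
    (1 - δ) * ‖∑ i ∈ A, c i • e i‖ ^ 2 ≤ ‖L (∑ i ∈ A, c i • e i)‖ ^ 2 ∧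
      ‖L (∑ i ∈ A, c i • e i)‖ ^ 2 ≤ (1 + δ) * ‖∑ i ∈ A, c i • e i‖ ^ 2

variable {L : E →ₗ[ℝ] F} {e : ι → E} {n : ℕ} {δ : ℝ}

theorem RestrictedIsometry.sum (h : RestrictedIsometry L e n δ) {A : Finset ι} (hA : A.card ≤ n) :
    (1 - δ) * ‖∑ i ∈ A, e i‖ ^ 2 ≤ ‖L (∑ i ∈ A, e i)‖ ^ 2 ∧
      ‖L (∑ i ∈ A, e i)‖ ^ 2 ≤ (1 + δ) * ‖∑ i ∈ A, e i‖ ^ 2 := by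
  simpa using h A (fun _ => 1) hA

theorem norm_sq_sum_smul (he : Pairwise fun i j => inner ℝ (e i) (e j) = 0) (A : Finset ι)
    (c : ι → ℝ) : ‖∑ i ∈ A, c i • e i‖ ^ 2 = ∑ i ∈ A, c i ^ 2 * ‖e i‖ ^ 2 := by
  classical
  rw [← real_inner_self_eq_norm_sq, sum_inner]
  refine sum_congr rfl fun i hi => ?_
  rw [inner_sum, sum_eq_single_of_mem i hi]
  · rw [inner_smul_left, inner_smul_right, real_inner_self_eq_norm_sq]
    simp
    ring
  · intro j _ hj
    rw [inner_smul_left, inner_smul_right, he hj.symm]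
    simp

theorem norm_sq_sum_orthogonal (he : Pairwise fun i j => inner ℝ (e i) (e j) = 0)
    (A : Finset ι) : ‖∑ i ∈ A, e i‖ ^ 2 = ∑ i ∈ A, ‖e i‖ ^ 2 := by
  simpa using norm_sq_sum_smul he A fun _ => 1

theorem RestrictedIsometry.add_smul [DecidableEq ι] (h : RestrictedIsometry L e n δ)
    (he : Pairwise fun i j => inner ℝ (e i) (e j) = 0) {A B : Finset ι} (hAB : Disjoint A B)
    (hn : A.card + B.card ≤ n) (c : ι → ℝ) (p : ℝ) :
    (1 - δ) * (‖∑ i ∈ A, e i‖ ^ 2 + p ^ 2 * ‖∑ i ∈ B, c i • e i‖ ^ 2) ≤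
        ‖L (∑ i ∈ A, e i + p • ∑ i ∈ B, c i • e i)‖ ^ 2 ∧
      ‖L (∑ i ∈ A, e i + p • ∑ i ∈ B, c i • e i)‖ ^ 2 ≤
        (1 + δ) * (‖∑ i ∈ A, e i‖ ^ 2 + p ^ 2 * ‖∑ i ∈ B, c i • e i‖ ^ 2) := by
  have hA : ∀ i ∈ A, (if i ∈ A then 1 else p * c i) = 1 := fun i hi => if_pos hi
  have hB : ∀ i ∈ B, (if i ∈ A then 1 else p * c i) = p * c i :=
    fun i hi => if_neg (disjoint_right.1 hAB hi)
  have hv : ∑ i ∈ A ∪ B, (if i ∈ A then 1 else p * c i) • e i =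
      ∑ i ∈ A, e i + p • ∑ i ∈ B, c i • e i := by
    rw [sum_union hAB, smul_sum]
    congr 1
    · exact sum_congr rfl fun i hi => by rw [hA i hi, one_smul]
    · exact sum_congr rfl fun i hi => by rw [hB i hi, mul_smul]
  have hnorm : ‖∑ i ∈ A ∪ B, (if i ∈ A then 1 else p * c i) • e i‖ ^ 2 =
      ‖∑ i ∈ A, e i‖ ^ 2 + p ^ 2 * ‖∑ i ∈ B, c i • e i‖ ^ 2 := by
    rw [norm_sq_sum_smul he, sum_union hAB, norm_sq_sum_orthogonal he, norm_sq_sum_smul he, mul_sum]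
    congr 1
    · exact sum_congr rfl fun i hi => by rw [hA i hi]; ring
    · exact sum_congr rfl fun i hi => by rw [hB i hi]; ring
  have := h (A ∪ B) (fun i => if i ∈ A then 1 else p * c i) (by rwa [card_union_of_disjoint hAB])
  rw [hnorm, hv] at this
  exact this

/-- The weights are chosen so that ‖y‖² cancels; the result is affine in `y`, which permits passing
to convex combinations. -/
theorem norm_sq_add_smul_combination (x y : F) (p q : ℝ) :
    q ^ 2 * ‖x + p • y‖ ^ 2 - p ^ 2 * ‖x + (-q) • y‖ ^ 2 =
      (q ^ 2 - p ^ 2) * ‖x‖ ^ 2 + 2 * p * q * (p + q) * inner ℝ x y := by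
  rw [norm_add_sq_real, norm_add_sq_real, norm_smul, norm_smul, inner_smul_right,
    inner_smul_right, mul_pow, mul_pow, Real.norm_eq_abs, Real.norm_eq_abs, sq_abs, sq_abs]
  ring

/-- The restricted isometry property tested against a vector `∑ i ∈ D, e i` which is a convex
combination of `b`-sparse vectors. -/
theorem RestrictedIsometry.inner_lower_bound [Fintype ι] [DecidableEq ι]
    (h : RestrictedIsometry L e n δ) (hδ : 0 ≤ δ)
    (he : Pairwise fun i j => inner ℝ (e i) (e j) = 0) {A D : Finset ι} (hAD : Disjoint A D)
    {b : ℕ} (hn : A.card + b ≤ n) {β : ℝ} (hβ0 : 0 ≤ β) (hβ : ∀ i ∈ D, ‖e i‖ ≤ β)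
    (hsum : ∑ i ∈ D, ‖e i‖ ≤ b * β) {p q : ℝ} :
    (q ^ 2 - p ^ 2) * ‖∑ i ∈ A, e i‖ ^ 2 -
        δ * ((q ^ 2 + p ^ 2) * ‖∑ i ∈ A, e i‖ ^ 2 + 2 * p ^ 2 * q ^ 2 * (b * β ^ 2)) ≤
      (q ^ 2 - p ^ 2) * ‖L (∑ i ∈ A, e i)‖ ^ 2 +
        2 * p * q * (p + q) * inner ℝ (L (∑ i ∈ A, e i)) (L (∑ i ∈ D, e i)) := by
  set v := ∑ i ∈ A, e i with hv
  -- All nonzero vectors `w i` have norm β, so `y i = ‖e i‖ / β` recovers the blocks in `D`, and a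
  -- sum of at most `b` of the `w i` has squared norm at most bβ².
  set w : ι → E := fun i => if i ∈ D then (β / ‖e i‖) • e i else 0 with hw
  set f : (ι → ℝ) →ₗ[ℝ] ℝ := (2 * p * q * (p + q)) •
    ((innerₛₗ ℝ (L v)).comp (L.comp (Fintype.linearCombination ℝ w))) with hf
  have hfy : ∀ y, f y = 2 * p * q * (p + q) * inner ℝ (L v) (L (∑ i, y i • w i)) := by
    intro y
    simp [hf, Fintype.linearCombination_apply]
  have hβi : ∀ i, (‖e i‖ / β * (β / ‖e i‖)) • e i = e i ∨ β = 0 := by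
    intro i
    by_cases hb : β = 0
    · exact Or.inr hb
    left
    by_cases hi : e i = 0
    · simp [hi]
    · have := norm_ne_zero_iff.2 hi
      rw [show ‖e i‖ / β * (β / ‖e i‖) = 1 by field_simp, one_smul]
  have hu : ∑ i, (if i ∈ D then ‖e i‖ / β else 0) • w i = ∑ i ∈ D, e i := by
    rw [← sum_subset (subset_univ D) (fun i _ hi => by simp [hi])]
    refine sum_congr rfl fun i hi => ?_
    rw [hw]
    simp only [hi, if_true]
    rw [smul_smul]
    rcases hβi i with h' | h'
    · exact h'
    · have : e i = 0 := norm_le_zero_iff.1 (h' ▸ hβ i hi)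
      simp [this]
  have key := le_linear_of_le_indicator f b
    ((q ^ 2 - p ^ 2) * ‖v‖ ^ 2 - δ * ((q ^ 2 + p ^ 2) * ‖v‖ ^ 2 + 2 * p ^ 2 * q ^ 2 * (b * β ^ 2))
      - (q ^ 2 - p ^ 2) * ‖L v‖ ^ 2) ?_ (fun i => if i ∈ D then ‖e i‖ / β else 0) ?_ ?_ ?_
  · rw [hfy, hu] at key
    linarith
  · intro B hB
    have hB' : (B ∩ D).card ≤ b := (card_le_card inter_subset_left).trans hB
    have hwB : ∑ i, (if i ∈ B then (1 : ℝ) else 0) • w i = ∑ i ∈ B ∩ D, (β / ‖e i‖) • e i := by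
      simp only [hw, ite_smul, one_smul, zero_smul, sum_ite_mem, univ_inter,
        inter_comm B]
    have hdisj : Disjoint A (B ∩ D) := hAD.mono_right inter_subset_right
    have hcard : A.card + (B ∩ D).card ≤ n := by omega
    have h1 := (h.add_smul he hdisj hcard (fun i => β / ‖e i‖) p).1
    have h2 := (h.add_smul he hdisj hcard (fun i => β / ‖e i‖) (-q)).2
    have hW : ‖∑ i ∈ B ∩ D, (β / ‖e i‖) • e i‖ ^ 2 ≤ b * β ^ 2 := by
      rw [norm_sq_sum_smul he]
      calc ∑ i ∈ B ∩ D, (β / ‖e i‖) ^ 2 * ‖e i‖ ^ 2 ≤ ∑ i ∈ B ∩ D, β ^ 2 := by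
            refine sum_le_sum fun i _ => ?_
            rw [← mul_pow]
            by_cases hi : ‖e i‖ = 0
            · rw [hi]; simp; positivity
            · rw [div_mul_cancel₀ _ hi]
        _ = (B ∩ D).card * β ^ 2 := by rw [sum_const, nsmul_eq_mul]
        _ ≤ b * β ^ 2 := by gcongr
    rw [hfy, hwB]
    set W := ∑ i ∈ B ∩ D, (β / ‖e i‖) • e i
    have hid := norm_sq_add_smul_combination (L v) (L W) p q
    simp only [map_add, map_smul] at h1 h2
    have h1' := mul_le_mul_of_nonneg_left h1 (sq_nonneg q)
    have h2' := mul_le_mul_of_nonneg_left h2 (sq_nonneg p)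
    have h3 := mul_le_mul_of_nonneg_left hW (show 0 ≤ δ * (2 * p ^ 2 * q ^ 2) by positivity)
    linarith
  · intro i
    split_ifs <;> positivity
  · intro i
    split_ifs with hi
    · exact div_le_one_of_le₀ (hβ i hi) hβ0
    · exact zero_le_one
  · rw [sum_ite_mem, univ_inter, ← sum_div]
    exact div_le_of_le_mul₀ hβ0 (by positivity) hsum

/-- Averaging the squared norms `‖L (∑ i ∈ A, e i)‖ ^ 2` over the `a`-subsets `A` of `T`. -/
theorem sum_powersetCard_norm_sq_map_sum [DecidableEq ι] (L : E →ₗ[ℝ] F) (e : ι → E)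
    (T : Finset ι) {a : ℕ} (ha : 1 ≤ a) (haT : a ≤ T.card) :
    ((T.card : ℝ) - 1) * ∑ A ∈ powersetCard a T, ‖L (∑ i ∈ A, e i)‖ ^ 2 =
      (T.card - 1).choose (a - 1) *
        ((T.card - a) * ∑ i ∈ T, ‖L (e i)‖ ^ 2 + (a - 1) * ‖L (∑ i ∈ T, e i)‖ ^ 2) := by
  have hexp : ∀ A : Finset ι, ‖L (∑ i ∈ A, e i)‖ ^ 2 =
      ∑ i ∈ A, ∑ j ∈ A, inner ℝ (L (e i)) (L (e j)) := by
    intro A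
    rw [← real_inner_self_eq_norm_sq, map_sum, sum_inner]
    simp_rw [inner_sum]
  simp only [hexp, ← real_inner_self_eq_norm_sq (L (e _))]
  exact sum_powersetCard_sum_sum T ha haT fun i j => inner ℝ (L (e i)) (L (e j))

theorem sum_sum_norm_sub_sq (T : Finset ι) (g : ι → E) :
    ∑ i ∈ T, ∑ j ∈ T, ‖g i - g j‖ ^ 2 =
      2 * (T.card * ∑ i ∈ T, ‖g i‖ ^ 2 - ‖∑ i ∈ T, g i‖ ^ 2) := by
  simp only [norm_sub_sq_real, sum_add_distrib, sum_sub_distrib, sum_const, nsmul_eq_mul,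
    ← mul_sum]
  rw [← real_inner_self_eq_norm_sq (∑ i ∈ T, g i), sum_inner]
  simp_rw [inner_sum]
  ring

/-- `‖L (e i - e j)‖ ^ 2` summed over all pairs. -/
theorem RestrictedIsometry.pair_differences [DecidableEq ι] (h : RestrictedIsometry L e n δ)
    (he : Pairwise fun i j => inner ℝ (e i) (e j) = 0) (hn : 2 ≤ n) (T : Finset ι) :
    0 ≤ T.card * ∑ i ∈ T, ‖L (e i)‖ ^ 2 - ‖L (∑ i ∈ T, e i)‖ ^ 2 ∧
    T.card * ∑ i ∈ T, ‖L (e i)‖ ^ 2 - ‖L (∑ i ∈ T, e i)‖ ^ 2 ≤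
      (1 + δ) * (T.card - 1) * ‖∑ i ∈ T, e i‖ ^ 2 := by
  have h1 := sum_sum_norm_sub_sq T fun i => L (e i)
  have h2 := sum_sum_norm_sub_sq T e
  rw [← map_sum] at h1
  rw [← norm_sq_sum_orthogonal he] at h2
  have h3 : ∑ i ∈ T, ∑ j ∈ T, ‖L (e i) - L (e j)‖ ^ 2 ≤
      ∑ i ∈ T, ∑ j ∈ T, (1 + δ) * ‖e i - e j‖ ^ 2 := by
    refine sum_le_sum fun i _ => sum_le_sum fun j _ => ?_
    by_cases hij : i = j
    · simp [hij]
    · have := (h.add_smul he (A := {i}) (B := {j}) (by simpa using hij) (by simpa using hn)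
        (fun _ => 1) (-1)).2
      have hn' := norm_sub_sq_real (e i) (e j)
      rw [he hij] at hn'
      rw [hn']
      simpa [← sub_eq_add_neg] using this
  have h0 : 0 ≤ ∑ i ∈ T, ∑ j ∈ T, ‖L (e i) - L (e j)‖ ^ 2 := by positivity
  simp_rw [← mul_sum] at h3
  rw [h1, h2] at h3
  constructor <;> linarith

end OrthogonalBlocks

/-! ### The key inequality -/

section KeyInequality

variable {ι E F : Type*} [NormedAddCommGroup E] [InnerProductSpace ℝ E]
  [NormedAddCommGroup F] [InnerProductSpace ℝ F] {L : E →ₗ[ℝ] F} {e : ι → E} {n : ℕ} {δ : ℝ}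

theorem sum_powersetCard_norm_sq_sum [DecidableEq ι]
    (he : Pairwise fun i j => inner ℝ (e i) (e j) = 0) (T : Finset ι) {a : ℕ} (ha : 1 ≤ a) :
    ∑ A ∈ powersetCard a T, ‖∑ i ∈ A, e i‖ ^ 2 =
      (T.card - 1).choose (a - 1) * ‖∑ i ∈ T, e i‖ ^ 2 := by
  simp only [norm_sq_sum_orthogonal he]
  exact sum_powersetCard_sum T ha fun i => ‖e i‖ ^ 2

theorem sum_powersetCard_inner [DecidableEq ι] (L : E →ₗ[ℝ] F) (e : ι → E) (T : Finset ι) {a : ℕ}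
    (ha : 1 ≤ a) (y : F) :
    ∑ A ∈ powersetCard a T, inner ℝ (L (∑ i ∈ A, e i)) y =
      (T.card - 1).choose (a - 1) * inner ℝ (L (∑ i ∈ T, e i)) y := by
  simp only [map_sum, sum_inner]
  exact sum_powersetCard_sum T ha fun i => inner ℝ (L (e i)) y

/-- Bounds for `L` on vectors with more blocks than the order of the isometry property. -/
theorem RestrictedIsometry.beyond_order [DecidableEq ι] (h : RestrictedIsometry L e n δ)
    (he : Pairwise fun i j => inner ℝ (e i) (e j) = 0) (hn : 2 ≤ n) {T : Finset ι}
    (hnT : n ≤ T.card) :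
    (n * (1 + δ) - 2 * T.card * δ) * ‖∑ i ∈ T, e i‖ ^ 2 ≤ n * ‖L (∑ i ∈ T, e i)‖ ^ 2 ∧
      n * ‖L (∑ i ∈ T, e i)‖ ^ 2 ≤ T.card * (1 + δ) * ‖∑ i ∈ T, e i‖ ^ 2 := by
  have havg := sum_powersetCard_norm_sq_map_sum L e T (by omega : 1 ≤ n) hnT
  have hsq := sum_powersetCard_norm_sq_sum he T (by omega : 1 ≤ n)
  obtain ⟨hU0, hU1⟩ := h.pair_differences he hn T
  have hlo : ∑ A ∈ powersetCard n T, (1 - δ) * ‖∑ i ∈ A, e i‖ ^ 2 ≤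
      ∑ A ∈ powersetCard n T, ‖L (∑ i ∈ A, e i)‖ ^ 2 :=
    sum_le_sum fun A hA => (h.sum (mem_powersetCard.1 hA).2.le).1
  have hhi : ∑ A ∈ powersetCard n T, ‖L (∑ i ∈ A, e i)‖ ^ 2 ≤
      ∑ A ∈ powersetCard n T, (1 + δ) * ‖∑ i ∈ A, e i‖ ^ 2 :=
    sum_le_sum fun A hA => (h.sum (mem_powersetCard.1 hA).2.le).2
  rw [← mul_sum, hsq] at hlo hhi
  have hN : (0 : ℝ) < (T.card - 1).choose (n - 1) := by
    exact_mod_cast Nat.choose_pos (by omega)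
  have hσ : (n : ℝ) ≤ T.card := by exact_mod_cast hnT
  have hn' : (2 : ℝ) ≤ n := by exact_mod_cast hn
  generalize ((T.card - 1).choose (n - 1) : ℝ) = N at *
  generalize (T.card : ℝ) = σ at *
  generalize ‖L (∑ i ∈ T, e i)‖ ^ 2 = G at *
  generalize ‖∑ i ∈ T, e i‖ ^ 2 = X at *
  generalize ∑ i ∈ T, ‖L (e i)‖ ^ 2 = P at *
  generalize ∑ A ∈ powersetCard n T, ‖L (∑ i ∈ A, e i)‖ ^ 2 = R at *
  have hσ1 : 0 < σ - 1 := by linarith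
  have hlo' : (σ - 1) * ((1 - δ) * X) ≤ (σ - n) * P + (n - 1) * G := by
    refine le_of_mul_le_mul_left ?_ hN
    rw [← havg]
    linarith [mul_le_mul_of_nonneg_left hlo hσ1.le]
  have hhi' : (σ - n) * P + (n - 1) * G ≤ (σ - 1) * ((1 + δ) * X) := by
    refine le_of_mul_le_mul_left ?_ hN
    rw [← havg]
    linarith [mul_le_mul_of_nonneg_left hhi hσ1.le]
  -- The averages involve P = ∑ ‖L (e i)‖²; the bounds G ≤ σP ≤ G + (1+δ)(σ-1)X eliminate it in
  -- either direction.
  have hU0' := mul_nonneg (sub_nonneg.2 hσ) hU0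
  have hU1' := mul_le_mul_of_nonneg_left hU1 (sub_nonneg.2 hσ)
  have hσ0 : 0 < σ := by linarith
  have hlo'' := mul_le_mul_of_nonneg_left hlo' hσ0.le
  have hhi'' := mul_le_mul_of_nonneg_left hhi' hσ0.le
  constructor
  · refine le_of_mul_le_mul_left ?_ hσ1
    linarith
  · refine le_of_mul_le_mul_left ?_ hσ1
    linarith

/-- The isometry property tested on `a` blocks inside `T` and `b ≤ a` blocks outside, averaged. -/
theorem RestrictedIsometry.split_lower_bound [Fintype ι] [DecidableEq ι]
    (h : RestrictedIsometry L e n δ) (hδ : 0 ≤ δ)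
    (he : Pairwise fun i j => inner ℝ (e i) (e j) = 0) (hn : 2 ≤ n) {T D : Finset ι}
    (hTD : Disjoint T D) (hT2 : 2 ≤ T.card) {a b : ℕ} (hb : 1 ≤ b) (hba : b ≤ a) (haT : a ≤ T.card)
    (hab : a + b ≤ n) {α : ℝ} (hα : ∀ i ∈ D, ‖e i‖ ≤ α) (hα0 : 0 ≤ α)
    (hsum : ∑ i ∈ D, ‖e i‖ ≤ T.card * α) :
    (a ^ 2 - b ^ 2) * ‖∑ i ∈ T, e i‖ ^ 2 -
        δ * ((2 * a * T.card - (a ^ 2 - b ^ 2)) * ‖∑ i ∈ T, e i‖ ^ 2 +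
          2 * b * T.card * (T.card * α ^ 2)) ≤
      (a ^ 2 - b ^ 2) * ‖L (∑ i ∈ T, e i)‖ ^ 2 +
        2 * b * (a + b) * inner ℝ (L (∑ i ∈ T, e i)) (L (∑ i ∈ D, e i)) := by
  have ha : 1 ≤ a := hb.trans hba
  have hb0 : (0 : ℝ) < b := by exact_mod_cast hb
  have ha0 : (0 : ℝ) < a := by exact_mod_cast ha
  have hba' : (b : ℝ) ≤ a := by exact_mod_cast hba
  have haT' : (a : ℝ) ≤ T.card := by exact_mod_cast haT
  have hs2 : (2 : ℝ) ≤ T.card := by exact_mod_cast hT2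
  have hs0 : (0 : ℝ) < T.card := by linarith
  have hbs : (b : ℝ) ≤ T.card := hba'.trans haT'
  have havg := sum_powersetCard_norm_sq_map_sum L e T ha haT
  have hsq := sum_powersetCard_norm_sq_sum he T ha
  have hin := sum_powersetCard_inner L e T ha (L (∑ i ∈ D, e i))
  have hU1 := (h.pair_differences he hn T).2
  have hI : ∀ A ∈ powersetCard a T,
      (a ^ 2 - b ^ 2) * ‖∑ i ∈ A, e i‖ ^ 2 -
        δ * ((a ^ 2 + b ^ 2) * ‖∑ i ∈ A, e i‖ ^ 2 + 2 * a ^ 2 * b * α ^ 2) ≤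
      (a ^ 2 - b ^ 2) * ‖L (∑ i ∈ A, e i)‖ ^ 2 +
        2 * a * b * (a + b) / T.card * inner ℝ (L (∑ i ∈ A, e i)) (L (∑ i ∈ D, e i)) := by
    intro A hA
    obtain ⟨hAT, hAc⟩ := mem_powersetCard.1 hA
    -- β concentrates the total mass σα (σ = `T.card`) on `b` blocks; p = b/σ scales them back to
    -- norm α, and q/p = a/b.
    have := h.inner_lower_bound hδ he (hTD.mono_left hAT) (b := b) (by omega)
      (β := T.card * α / b) (by positivity)
      (fun i hi => (hα i hi).trans (by
        rw [le_div_iff₀ hb0]; nlinarith))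
      (by rwa [mul_div_cancel₀ _ hb0.ne']) (p := b / T.card) (q := a / T.card)
    have h' := mul_le_mul_of_nonneg_left this (sq_nonneg (T.card : ℝ))
    refine le_of_eq_of_le ?_ (h'.trans_eq ?_)
    · field_simp
    · field_simp
      ring
  have hS := sum_le_sum hI
  simp only [sum_add_distrib, sum_sub_distrib, ← mul_sum] at hS
  rw [hsq, hin, sum_const, card_powersetCard, nsmul_eq_mul] at hS
  have hch : (a : ℝ) * T.card.choose a = T.card * (T.card - 1).choose (a - 1) := by
    obtain ⟨m, hm⟩ : ∃ m, T.card = m + 1 := ⟨T.card - 1, by omega⟩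
    obtain ⟨k, rfl⟩ : ∃ k, a = k + 1 := ⟨a - 1, by omega⟩
    rw [hm, Nat.add_sub_cancel, Nat.add_sub_cancel, mul_comm]
    exact_mod_cast (Nat.add_one_mul_choose_eq m k).symm
  have hN : (0 : ℝ) < (T.card - 1).choose (a - 1) := by
    exact_mod_cast Nat.choose_pos (by omega)
  generalize (T.card.choose a : ℝ) = K at *
  generalize ((T.card - 1).choose (a - 1) : ℝ) = N at *
  generalize (T.card : ℝ) = σ at *
  generalize ‖L (∑ i ∈ T, e i)‖ ^ 2 = G at *
  generalize ‖∑ i ∈ T, e i‖ ^ 2 = X at *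
  generalize ∑ i ∈ T, ‖L (e i)‖ ^ 2 = P at *
  generalize ∑ A ∈ powersetCard a T, ‖L (∑ i ∈ A, e i)‖ ^ 2 = R at *
  generalize inner ℝ (L (∑ i ∈ T, e i)) (L (∑ i ∈ D, e i)) = Z at *
  have hσ1 : 0 < σ - 1 := by linarith
  have hd : (0 : ℝ) ≤ a ^ 2 - b ^ 2 := by nlinarith
  have h1 : (σ - 1) * ((a ^ 2 - b ^ 2) * X - δ * ((a ^ 2 + b ^ 2) * X + 2 * a * b * (σ * α ^ 2))) ≤
      (a ^ 2 - b ^ 2) * ((σ - a) * P + (a - 1) * G) +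
        (σ - 1) * (2 * a * b * (a + b) / σ * Z) := by
    refine le_of_mul_le_mul_left ?_ hN
    have := mul_le_mul_of_nonneg_left hS hσ1.le
    refine le_of_eq_of_le ?_ (this.trans_eq ?_)
    · linear_combination (σ - 1) * δ * 2 * a * b * α ^ 2 * hch
    · linear_combination (a ^ 2 - b ^ 2) * havg
  -- P carries the weight (a²-b²)(σ-a), nonnegative because b ≤ a ≤ σ, so its upper bound applies.
  have h2 := mul_le_mul_of_nonneg_left hU1 (mul_nonneg hd (sub_nonneg.2 haT'))
  have h3 := mul_le_mul_of_nonneg_left h1 hs0.le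
  have hZ : σ * ((σ - 1) * (2 * a * b * (a + b) / σ * Z)) =
      (σ - 1) * (2 * a * b * (a + b) * Z) := by field_simp
  refine le_of_mul_le_mul_left ?_ (mul_pos hσ1 ha0)
  linarith [h2, h3, hZ]

/-- The isometry property tested on all blocks of `T` and `m` blocks outside. -/
theorem RestrictedIsometry.full_lower_bound [Fintype ι] [DecidableEq ι]
    (h : RestrictedIsometry L e n δ) (hδ : 0 ≤ δ)
    (he : Pairwise fun i j => inner ℝ (e i) (e j) = 0) {T D : Finset ι}
    (hTD : Disjoint T D) {m : ℕ} (hm : 1 ≤ m) (hmT : m ≤ T.card)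
    (hn : T.card + m ≤ n) {α : ℝ} (hα : ∀ i ∈ D, ‖e i‖ ≤ α) (hα0 : 0 ≤ α)
    (hsum : ∑ i ∈ D, ‖e i‖ ≤ T.card * α) (p : ℝ) :
    (1 - p ^ 2) * ‖∑ i ∈ T, e i‖ ^ 2 -
        δ * ((1 + p ^ 2) * ‖∑ i ∈ T, e i‖ ^ 2 +
          2 * p ^ 2 * (T.card / m) * (T.card * α ^ 2)) ≤
      (1 - p ^ 2) * ‖L (∑ i ∈ T, e i)‖ ^ 2 +
        2 * p * (p + 1) * inner ℝ (L (∑ i ∈ T, e i)) (L (∑ i ∈ D, e i)) := by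
  have hm0 : (0 : ℝ) < m := by exact_mod_cast hm
  have hmT' : (m : ℝ) ≤ T.card := by exact_mod_cast hmT
  have := h.inner_lower_bound hδ he hTD (b := m) hn (β := T.card * α / m) (by positivity)
    (fun i hi => (hα i hi).trans (by rw [le_div_iff₀ hm0]; nlinarith))
    (by rwa [mul_div_cancel₀ _ hm0.ne']) (p := p) (q := 1)
  refine le_of_eq_of_le ?_ (this.trans_eq ?_)
  · field_simp
  · ring

/-- The restricted isometry inequality on the blocks of `T`, where the blocks in `D` are dominated
in sup norm and in mixed norm by `T.card` blocks of norm `α`. -/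
theorem RestrictedIsometry.key_inequality [Fintype ι] [DecidableEq ι]
    (h : RestrictedIsometry L e n δ) (hδ : 0 ≤ δ)
    (he : Pairwise fun i j => inner ℝ (e i) (e j) = 0) (hn : 2 ≤ n) {T D : Finset ι}
    (hTD : Disjoint T D) (hT2 : 2 ≤ T.card) (hnT : n ≤ 2 * T.card) {t : ℝ} (ht0 : 0 ≤ t)
    (ht : t ≤ 4 / 3) (htn : t * T.card ≤ n) {α : ℝ} (hα : ∀ i ∈ D, ‖e i‖ ≤ α) (hα0 : 0 ≤ α)
    (hsum : ∑ i ∈ D, ‖e i‖ ≤ T.card * α) :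
    t * (1 + δ) * ‖∑ i ∈ T, e i‖ ^ 2 ≤
      t * (‖L (∑ i ∈ T, e i)‖ ^ 2 + inner ℝ (L (∑ i ∈ T, e i)) (L (∑ i ∈ D, e i))) +
        δ * (3 * ‖∑ i ∈ T, e i‖ ^ 2 + T.card * α ^ 2) := by
  have hs2 : (2 : ℝ) ≤ T.card := by exact_mod_cast hT2
  have hn2 : (2 : ℝ) ≤ n := by exact_mod_cast hn
  have hy0 : 0 ≤ T.card * α ^ 2 := by positivity
  rcases Nat.lt_or_ge (4 * T.card) (3 * n) with h43 | h43
  -- p = 1/3 solves 1 - p² = 2p(p+1), giving ‖L h_T‖² and the cross term equal weights. Here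
  -- `T.card` ≤ 3m, and the resulting factor 3/4 is absorbed by t ≤ 4/3.
  · have hfull := h.full_lower_bound hδ he hTD (m := n - T.card) (by omega) (by omega) (by omega)
      hα hα0 hsum (1 / 3)
    have hm : (T.card : ℝ) / (n - T.card : ℕ) ≤ 3 := by
      have hm0 : 0 < n - T.card := by omega
      rw [div_le_iff₀ (by exact_mod_cast hm0)]
      exact_mod_cast (by omega : T.card ≤ 3 * (n - T.card))
    have hm' := mul_le_mul_of_nonneg_left hm (mul_nonneg hδ hy0)
    have h1 : (1 + δ) * ‖∑ i ∈ T, e i‖ ^ 2 -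
        (‖L (∑ i ∈ T, e i)‖ ^ 2 + inner ℝ (L (∑ i ∈ T, e i)) (L (∑ i ∈ D, e i))) ≤
        3 / 4 * (δ * (3 * ‖∑ i ∈ T, e i‖ ^ 2 + T.card * α ^ 2)) := by
      linarith
    have h2 := mul_le_mul_of_nonneg_left h1 ht0
    have h3 := mul_le_mul_of_nonneg_right ht
      (show 0 ≤ δ * (3 * ‖∑ i ∈ T, e i‖ ^ 2 + T.card * α ^ 2) by positivity)
    linarith
  · have main : n * ((1 + δ) * ‖∑ i ∈ T, e i‖ ^ 2) ≤
        n * (‖L (∑ i ∈ T, e i)‖ ^ 2 + inner ℝ (L (∑ i ∈ T, e i)) (L (∑ i ∈ D, e i))) +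
        T.card * (δ * (3 * ‖∑ i ∈ T, e i‖ ^ 2 + T.card * α ^ 2)) := by
      -- The order n is split as evenly as possible, a = b + r blocks inside `T` and b outside. For
      -- even n the split bounds the cross term alone.
      obtain ⟨b, r, hnb, hr⟩ : ∃ b r : ℕ, n = 2 * b + r ∧ (r = 0 ∨ r = 1) :=
        ⟨n / 2, n % 2, by omega, by omega⟩
      have hb1 : 1 ≤ b := by omega
      have hsplit := h.split_lower_bound hδ he hn hTD hT2 (a := b + r) hb1 (by omega) (by omega)
        (by omega) hα hα0 hsum
      have hb1' : (1 : ℝ) ≤ b := by exact_mod_cast hb1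
      have hnb' : (n : ℝ) = 2 * b + r := by exact_mod_cast hnb
      have hr' : (r : ℝ) = 0 ∨ (r : ℝ) = 1 := by exact_mod_cast hr
      rcases le_or_gt n T.card with hns | hns
      -- The weights 2b (n even) and 2b - 1 (n odd) on `hlow` equalize the coefficients of G and Z.
      · have hlow := (h.beyond_order he hn hns).1
        push_cast at hsplit
        rw [hnb'] at hlow ⊢
        generalize (T.card : ℝ) = s at *
        generalize ‖L (∑ i ∈ T, e i)‖ ^ 2 = G at *
        generalize ‖∑ i ∈ T, e i‖ ^ 2 = X at *
        generalize inner ℝ (L (∑ i ∈ T, e i)) (L (∑ i ∈ D, e i)) = Z at *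
        refine le_of_mul_le_mul_left ?_ (show (0 : ℝ) < 2 * b by linarith)
        rcases hr' with hr' | hr' <;> rw [hr'] at hsplit hlow ⊢
        · have := mul_le_mul_of_nonneg_left hlow (show (0 : ℝ) ≤ 2 * b by linarith)
          linarith
        · have := mul_le_mul_of_nonneg_left hlow (show (0 : ℝ) ≤ 2 * b - 1 by linarith)
          linarith
      · obtain ⟨m, hm⟩ : ∃ m, n = T.card + m := ⟨n - T.card, by omega⟩
        have hm1 : 1 ≤ m := by omega
        have hfull := h.full_lower_bound hδ he hTD hm1 (by omega) hm.ge hα hα0 hsum (m / T.card)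
        have hm' : (n : ℝ) = T.card + m := by exact_mod_cast hm
        -- After division by n = s + m, the full test contributes (s-m)G + 2mZ. Adding s - 3m copies
        -- of Z balances it, hence this weight on `hsplit`; it is nonnegative since 3n ≤ 4s.
        have h3m : (0 : ℝ) ≤ T.card - 3 * m := by
          have : 3 * m ≤ T.card := by omega
          have : (3 : ℝ) * m ≤ T.card := by exact_mod_cast this
          linarith
        have hm0 : (0 : ℝ) < m := by exact_mod_cast hm1
        push_cast at hsplit
        generalize (T.card : ℝ) = s at *
        generalize ‖L (∑ i ∈ T, e i)‖ ^ 2 = G at *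
        generalize ‖∑ i ∈ T, e i‖ ^ 2 = X at *
        generalize inner ℝ (L (∑ i ∈ T, e i)) (L (∑ i ∈ D, e i)) = Z at *
        have hs0 : 0 < s := by linarith
        have hfull' : (s ^ 2 - m ^ 2) * X - δ * ((s ^ 2 + m ^ 2) * X + 2 * s * m * (s * α ^ 2)) ≤
            (s ^ 2 - m ^ 2) * G + 2 * m * (m + s) * Z := by
          have := mul_le_mul_of_nonneg_left hfull (sq_nonneg s)
          refine le_of_eq_of_le ?_ (this.trans_eq ?_)
          · field_simp
          · field_simp
        have h2 := mul_le_mul_of_nonneg_left hsplit h3m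
        have hs : s = 2 * b + r - m := by linarith
        rw [hnb']
        generalize (r : ℝ) = k at *
        rcases hr' with rfl | rfl
        · have h1 := mul_le_mul_of_nonneg_left hfull' (show (0 : ℝ) ≤ 2 * b by linarith)
          refine le_of_mul_le_mul_left ?_ (show (0 : ℝ) < (s - m) * (2 * b) by
            apply mul_pos <;> linarith)
          subst hs
          linarith
        · have h1 := mul_le_mul_of_nonneg_left hfull' (show (0 : ℝ) ≤ 2 * b - 1 by linarith)
          refine le_of_mul_le_mul_left ?_ (show (0 : ℝ) < (s - m) * (2 * b - 1) + (s - 3 * m) by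
            apply add_pos_of_pos_of_nonneg
            · apply mul_pos <;> linarith
            · linarith)
          subst hs
          linarith
    have hn0 : (0 : ℝ) < n := by linarith
    refine le_of_mul_le_mul_left ?_ hn0
    have h1 := mul_le_mul_of_nonneg_left main ht0
    have h2 := mul_le_mul_of_nonneg_right htn
      (show 0 ≤ δ * (3 * ‖∑ i ∈ T, e i‖ ^ 2 + T.card * α ^ 2) by positivity)
    linarith

end KeyInequality

/-! ### Auxiliary estimates -/

theorem le_of_quadratic_le {D x b c : ℝ} (hD : 0 < D) (hb : 0 ≤ b) (hc : 0 ≤ c)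
    (h : D * x ^ 2 ≤ b * x + c) : x ≤ (b + √(D * c)) / D := by
  rw [le_div_iff₀ hD]
  by_contra! hlt
  have hs := Real.sq_sqrt (mul_nonneg hD.le hc)
  have hs0 := Real.sqrt_nonneg (D * c)
  nlinarith [mul_le_mul_of_nonneg_left h hD.le]

/-- Off the common part, S and T have equally many elements, and each value on `T \ S` dominates
each value on `S \ T`. -/
theorem sum_le_sum_of_card_eq_of_largest {ι : Type*} [DecidableEq ι] {f : ι → ℝ} {S T : Finset ι}
    (hcard : S.card = T.card) (hT : ∀ i ∈ T, ∀ j ∉ T, f j ≤ f i) :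
    ∑ i ∈ S, f i ≤ ∑ i ∈ T, f i := by
  rw [← sum_sdiff_le_sum_sdiff]
  have hc : (S \ T).card = (T \ S).card := card_sdiff_comm hcard
  rcases (S \ T).eq_empty_or_nonempty with h | h
  · rw [h, card_empty] at hc
    rw [h, card_eq_zero.1 hc.symm]
  · obtain ⟨m, hm, hmax⟩ := exists_max_image (S \ T) f h
    calc ∑ i ∈ S \ T, f i ≤ (S \ T).card • f m := sum_le_card_nsmul _ _ _ hmax
      _ = (T \ S).card • f m := by rw [hc]
      _ ≤ ∑ i ∈ T \ S, f i := card_nsmul_le_sum _ _ _ fun i hi =>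
          hT i (mem_sdiff.1 hi).1 m (mem_sdiff.1 hm).2

theorem sum_norm_le_sqrt_mul {ι E : Type*} [NormedAddCommGroup E] [InnerProductSpace ℝ E]
    {e : ι → E} {s : ℕ} {T : Finset ι} (he : Pairwise fun i j => inner ℝ (e i) (e j) = 0)
    (hT : T.card ≤ s) :
    ∑ i ∈ T, ‖e i‖ ≤ √s * ‖∑ i ∈ T, e i‖ := by
  refine le_of_sq_le_sq ?_ (by positivity)
  rw [mul_pow, Real.sq_sqrt (Nat.cast_nonneg _), norm_sq_sum_orthogonal he]
  refine sq_sum_le_card_mul_sum_sq.trans ?_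
  gcongr

/-! ### Stability under the cone condition -/

section Stability

variable {ι E F : Type*} [NormedAddCommGroup E]
  [InnerProductSpace ℝ E] [NormedAddCommGroup F] [InnerProductSpace ℝ F] {L : E →ₗ[ℝ] F}
  {e : ι → E} {n s : ℕ} {δ t : ℝ} {T : Finset ι}

/-- An index outside `T` forces `T.card = s`; then s‖e j‖ ≤ ∑_T ‖e i‖ ≤ √s ‖h_T‖. -/
theorem norm_le_of_notMem [Fintype ι]
    (he : Pairwise fun i j => inner ℝ (e i) (e j) = 0) (hs : 0 < s)
    (hcard : T.card = min s (Fintype.card ι)) (hT : ∀ i ∈ T, ∀ j ∉ T, ‖e j‖ ≤ ‖e i‖)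
    {j : ι} (hj : j ∉ T) : ‖e j‖ ≤ ‖∑ i ∈ T, e i‖ / √s := by
  have hlt : T.card < Fintype.card ι := card_lt_univ_of_notMem hj
  have hTs : T.card = s := by omega
  have hs' : (0 : ℝ) < √s := Real.sqrt_pos.2 (by exact_mod_cast hs)
  rw [le_div_iff₀ hs']
  refine le_of_mul_le_mul_left ?_ hs'
  refine le_trans ?_ (sum_norm_le_sqrt_mul he hTs.le)
  have := card_nsmul_le_sum T (fun i => ‖e i‖) ‖e j‖ fun i hi => hT i hi j hj
  rw [hTs, nsmul_eq_mul] at this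
  refine le_of_eq_of_le ?_ this
  rw [mul_left_comm, Real.mul_self_sqrt (Nat.cast_nonneg _), mul_comm]

theorem RestrictedIsometry.head_inner_bound [Fintype ι] [DecidableEq ι]
    (h : RestrictedIsometry L e n δ) (hδ : 0 ≤ δ)
    (he : Pairwise fun i j => inner ℝ (e i) (e j) = 0) (hs : 2 ≤ s) (hn : 2 ≤ n)
    (hns : n ≤ 2 * s) (ht0 : 0 ≤ t) (ht : t ≤ 4 / 3) (htn : t * s ≤ n)
    (hcard : T.card = min s (Fintype.card ι)) (hT : ∀ i ∈ T, ∀ j ∉ T, ‖e j‖ ≤ ‖e i‖)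
    {ω : ℝ} (hω : 0 ≤ ω) (hcone : ∑ i ∈ Tᶜ, ‖e i‖ ≤ ∑ i ∈ T, ‖e i‖ + 2 * ω) :
    t * (1 + δ) * ‖∑ i ∈ T, e i‖ ^ 2 ≤
      t * inner ℝ (L (∑ i ∈ T, e i)) (L (∑ i, e i)) +
        δ * (3 * ‖∑ i ∈ T, e i‖ ^ 2 + (‖∑ i ∈ T, e i‖ + 2 * ω / √s) ^ 2) := by
  have hs0 : (0 : ℝ) < s := by exact_mod_cast (by omega : 0 < s)
  have hr0 : 0 < √(s : ℝ) := Real.sqrt_pos.2 hs0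
  have hn0 : (0 : ℝ) < n := by exact_mod_cast (by omega : 0 < n)
  have hrr : √(s : ℝ) ^ 2 = s := Real.sq_sqrt hs0.le
  have hTs : T.card ≤ s := by omega
  rw [← sum_add_sum_compl T e, map_add, inner_add_right, real_inner_self_eq_norm_sq]
  rcases hTs.eq_or_lt with hTs | hTs
  · have hαs : (s : ℝ) * ((‖∑ i ∈ T, e i‖ + 2 * ω / √s) / √s) =
        √s * ‖∑ i ∈ T, e i‖ + 2 * ω := by
      field_simp
      rw [hrr]
    have hsq : (s : ℝ) * ((‖∑ i ∈ T, e i‖ + 2 * ω / √s) / √s) ^ 2 =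
        (‖∑ i ∈ T, e i‖ + 2 * ω / √s) ^ 2 := by
      rw [div_pow, hrr]
      field_simp
    have hα : ∀ i ∈ Tᶜ, ‖e i‖ ≤ (‖∑ i ∈ T, e i‖ + 2 * ω / √s) / √s := by
      intro i hi
      refine (norm_le_of_notMem he (by omega) hcard hT (mem_compl.1 hi)).trans ?_
      gcongr
      simp only [le_add_iff_nonneg_right]
      positivity
    have := h.key_inequality hδ he hn disjoint_compl_right (by omega) (by omega) ht0 ht
      (by rwa [hTs]) hα (by positivity)
      (by rw [hTs, hαs]; linarith [sum_norm_le_sqrt_mul he hTs.le])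
    rwa [hTs, hsq] at this
  -- With fewer than s blocks the tail vanishes, and isometry bounds for h_T alone suffice.
  · have hTu : T = univ := by
      rw [← card_eq_iff_eq_univ]
      omega
    have hTc : Tᶜ = ∅ := by rw [hTu, compl_univ]
    rw [hTc, sum_empty, map_zero, inner_zero_right, add_zero]
    have hY : ‖∑ i ∈ T, e i‖ ^ 2 ≤ (‖∑ i ∈ T, e i‖ + 2 * ω / √s) ^ 2 := by
      gcongr
      simp only [le_add_iff_nonneg_right]
      positivity
    have hX0 : 0 ≤ ‖∑ i ∈ T, e i‖ ^ 2 := by positivity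
    have hY' := mul_le_mul_of_nonneg_left hY hδ
    have hδX := mul_nonneg hδ hX0
    rcases le_or_gt T.card n with hTn | hTn
    · have := mul_le_mul_of_nonneg_left (h.sum hTn).1 ht0
      have h2 := mul_le_mul_of_nonneg_right ht hδX
      linarith
    · have hlow := mul_le_mul_of_nonneg_left (h.beyond_order he hn hTn.le).1 ht0
      have hTs' : (T.card : ℝ) ≤ s := by exact_mod_cast hTs.le
      have h1 : t * T.card ≤ n := (mul_le_mul_of_nonneg_left hTs' ht0).trans htn
      have h2 := mul_le_mul_of_nonneg_right h1 hδX
      have h3 := mul_le_mul_of_nonneg_left hY' hn0.le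
      have h4 := mul_nonneg hn0.le hδX
      refine le_of_mul_le_mul_left ?_ hn0
      linarith

/-- Source of max(√t, t): the factor t comes from the isometry property when `T.card` ≤ n, the
factor √t from `RestrictedIsometry.beyond_order` when `T.card` > n. -/
theorem RestrictedIsometry.norm_map_head_le [DecidableEq ι]
    (h : RestrictedIsometry L e n δ) (hδ : 0 ≤ δ)
    (he : Pairwise fun i j => inner ℝ (e i) (e j) = 0) (hn : 2 ≤ n)
    (ht0 : 0 ≤ t) (htn : t * s ≤ n) (hTs : T.card ≤ s) :
    t * ‖L (∑ i ∈ T, e i)‖ ≤ max (√t) t * (√(1 + δ) * ‖∑ i ∈ T, e i‖) := by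
  have hn0 : (0 : ℝ) < n := by exact_mod_cast (by omega : 0 < n)
  rcases le_or_gt T.card n with hTn | hTn
  · have h1 : ‖L (∑ i ∈ T, e i)‖ ≤ √(1 + δ) * ‖∑ i ∈ T, e i‖ := by
      refine le_of_sq_le_sq ?_ (by positivity)
      rw [mul_pow, Real.sq_sqrt (by linarith)]
      exact (h.sum hTn).2
    exact mul_le_mul (le_max_right _ _) h1 (norm_nonneg _) (by positivity)
  · have hup := (h.beyond_order he hn hTn.le).2
    have hTs' : (T.card : ℝ) ≤ s := by exact_mod_cast hTs
    have h1 : t * T.card ≤ n := (mul_le_mul_of_nonneg_left hTs' ht0).trans htn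
    have h2 : t * ‖L (∑ i ∈ T, e i)‖ ^ 2 ≤ (1 + δ) * ‖∑ i ∈ T, e i‖ ^ 2 := by
      refine le_of_mul_le_mul_left ?_ hn0
      have h3 := mul_le_mul_of_nonneg_left hup ht0
      have h4 := mul_le_mul_of_nonneg_right h1
        (show 0 ≤ (1 + δ) * ‖∑ i ∈ T, e i‖ ^ 2 by positivity)
      linarith
    have h5 : √t * ‖L (∑ i ∈ T, e i)‖ ≤ √(1 + δ) * ‖∑ i ∈ T, e i‖ := by
      refine le_of_sq_le_sq ?_ (by positivity)
      rw [mul_pow, mul_pow, Real.sq_sqrt ht0,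
        Real.sq_sqrt (by linarith : 0 ≤ 1 + δ)]
      exact h2
    calc t * ‖L (∑ i ∈ T, e i)‖ = √t * (√t * ‖L (∑ i ∈ T, e i)‖) := by
          rw [← mul_assoc, Real.mul_self_sqrt ht0]
      _ ≤ max (√t) t * (√(1 + δ) * ‖∑ i ∈ T, e i‖) :=
          mul_le_mul (le_max_left _ _) h5 (by positivity) (by positivity)

/-- The squared tail is at most its largest norm times its sum, hence at most X² + 2ωX/√s;
completing the square in 2X² + 2ωX/√s gives the bound. -/
theorem norm_sum_le_of_cone [Fintype ι] [DecidableEq ι]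
    (he : Pairwise fun i j => inner ℝ (e i) (e j) = 0) (hs : 0 < s)
    (hcard : T.card = min s (Fintype.card ι)) (hT : ∀ i ∈ T, ∀ j ∉ T, ‖e j‖ ≤ ‖e i‖)
    {ω : ℝ} (hω : 0 ≤ ω) (hcone : ∑ i ∈ Tᶜ, ‖e i‖ ≤ ∑ i ∈ T, ‖e i‖ + 2 * ω) :
    ‖∑ i, e i‖ ≤ √2 * ‖∑ i ∈ T, e i‖ + 1 / 2 * √(2 / s) * ω := by
  have hs0 : (0 : ℝ) < s := by exact_mod_cast hs
  have hr0 : 0 < √(s : ℝ) := Real.sqrt_pos.2 hs0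
  have h2 : √(2 : ℝ) ^ 2 = 2 := Real.sq_sqrt (by norm_num)
  have htail : ∑ i ∈ Tᶜ, ‖e i‖ ^ 2 ≤
      ‖∑ i ∈ T, e i‖ / √s * (√s * ‖∑ i ∈ T, e i‖ + 2 * ω) := by
    calc ∑ i ∈ Tᶜ, ‖e i‖ ^ 2 ≤ ∑ i ∈ Tᶜ, ‖∑ i ∈ T, e i‖ / √s * ‖e i‖ := by
          refine sum_le_sum fun i hi => ?_
          rw [sq]
          exact mul_le_mul_of_nonneg_right
            (norm_le_of_notMem he hs hcard hT (mem_compl.1 hi)) (norm_nonneg _)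
      _ = ‖∑ i ∈ T, e i‖ / √s * ∑ i ∈ Tᶜ, ‖e i‖ := by rw [mul_sum]
      _ ≤ _ := by
          gcongr
          linarith [sum_norm_le_sqrt_mul he (T := T) (s := s) (by omega)]
  refine le_of_sq_le_sq ?_ (by positivity)
  rw [norm_sq_sum_orthogonal he, ← sum_add_sum_compl T, ← norm_sq_sum_orthogonal he T]
  have hexp : ‖∑ i ∈ T, e i‖ / √s * (√s * ‖∑ i ∈ T, e i‖ + 2 * ω) =
      ‖∑ i ∈ T, e i‖ ^ 2 + 2 * ω * ‖∑ i ∈ T, e i‖ / √s := by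
    field_simp
  have hexp2 : (√2 * ‖∑ i ∈ T, e i‖ + 1 / 2 * √(2 / s) * ω) ^ 2 =
      2 * ‖∑ i ∈ T, e i‖ ^ 2 + 2 * ω * ‖∑ i ∈ T, e i‖ / √s + (1 / 2 * √(2 / s) * ω) ^ 2 := by
    rw [Real.sqrt_div (by norm_num)]
    linear_combination
      (‖∑ i ∈ T, e i‖ ^ 2 + ‖∑ i ∈ T, e i‖ / √s * ω) * h2
  rw [hexp2]
  linarith [sq_nonneg (1 / 2 * √(2 / s) * ω)]

/-- Stability of the blocks `e` under the cone condition and the restricted isometry property. -/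
theorem RestrictedIsometry.norm_le_of_cone [Fintype ι] [DecidableEq ι]
    (h : RestrictedIsometry L e n δ) (hδ : 0 ≤ δ)
    (he : Pairwise fun i j => inner ℝ (e i) (e j) = 0) (hs : 2 ≤ s) (hn : 2 ≤ n)
    (hns : n ≤ 2 * s) (ht0 : 0 < t) (ht : t ≤ 4 / 3) (htn : t * s ≤ n) (hδt : δ < t / (4 - t))
    (hcard : T.card = min s (Fintype.card ι)) (hT : ∀ i ∈ T, ∀ j ∉ T, ‖e j‖ ≤ ‖e i‖)
    {ω ρ : ℝ} (hω : 0 ≤ ω) (hcone : ∑ i ∈ Tᶜ, ‖e i‖ ≤ ∑ i ∈ T, ‖e i‖ + 2 * ω)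
    (hρ : ‖L (∑ i, e i)‖ ≤ 2 * ρ) :
    ‖∑ i, e i‖ ≤ 2 * √2 * ρ * √(1 + δ) / (t + (t - 4) * δ) * max (√t) t
      + 1 / 2 * √(2 / s) * ((8 * δ + 4 * √((t + (t - 4) * δ) * δ)) / (t + (t - 4) * δ) + 1) * ω := by
  have hs0 : (0 : ℝ) < s := by exact_mod_cast (by omega : 0 < s)
  have hr0 : 0 < √(s : ℝ) := Real.sqrt_pos.2 hs0
  have hD : 0 < t + (t - 4) * δ := by
    rw [lt_div_iff₀ (by linarith)] at hδt
    linarith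
  have hρ0 : 0 ≤ ρ := by linarith [norm_nonneg (L (∑ i, e i))]
  have hkey := h.head_inner_bound hδ he hs hn hns ht0.le ht htn hcard hT hω hcone
  have hhead := h.norm_map_head_le hδ he hn ht0.le htn (T := T) (by omega)
  have hsum := norm_sum_le_of_cone he (by omega) hcard hT hω hcone
  set X := ‖∑ i ∈ T, e i‖
  set D := t + (t - 4) * δ
  have hinner : t * inner ℝ (L (∑ i ∈ T, e i)) (L (∑ i, e i)) ≤
      2 * ρ * √(1 + δ) * max (√t) t * X := by
    calc t * inner ℝ (L (∑ i ∈ T, e i)) (L (∑ i, e i))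
        ≤ t * (‖L (∑ i ∈ T, e i)‖ * ‖L (∑ i, e i)‖) := by
          gcongr
          exact real_inner_le_norm _ _
      _ = (t * ‖L (∑ i ∈ T, e i)‖) * ‖L (∑ i, e i)‖ := by ring
      _ ≤ (max (√t) t * (√(1 + δ) * X)) * (2 * ρ) := by gcongr
      _ = _ := by ring
  set τ := 2 * ω / √s with hτ
  have hτ0 : 0 ≤ τ := by positivity
  -- Expanding (X+τ)² moves 4δX² to the left, leaving D X² there.
  have hX := le_of_quadratic_le (x := X) hD
    (b := 2 * ρ * √(1 + δ) * max (√t) t + 2 * δ * τ) (c := δ * τ ^ 2)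
    (by positivity) (by positivity) (by simp only [D]; linarith)
  have hroot : √(D * (δ * τ ^ 2)) = √(D * δ) * τ := by
    rw [← mul_assoc, Real.sqrt_mul (by positivity), Real.sqrt_sq hτ0]
  rw [hroot] at hX
  refine hsum.trans ?_
  have := mul_le_mul_of_nonneg_left hX (Real.sqrt_nonneg 2)
  refine (add_le_add_left this _).trans_eq ?_
  rw [Real.sqrt_div (by norm_num), hτ]
  field_simp
  ring

end Stability

/-! ### Block vectors as orthogonal families -/

namespace BlockSparse

variable {l M : ℕ} {d : Fin l → ℕ}

theorem norm_sq_restrictBlocks (S : Finset (Fin l)) (x : Signal d) :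
    ‖restrictBlocks S x‖ ^ 2 = ∑ i ∈ S, ‖block x i‖ ^ 2 := by
  simp only [EuclideanSpace.norm_sq_eq, Fintype.sum_sigma, restrictBlocks, block]
  rw [← sum_subset (subset_univ S)]
  · exact sum_congr rfl fun i hi => by simp [hi]
  · intro i _ hi
    simp [hi]

theorem norm_restrictBlocks_singleton (x : Signal d) (i : Fin l) :
    ‖restrictBlocks {i} x‖ = ‖block x i‖ := by
  have := norm_sq_restrictBlocks {i} x
  rw [sum_singleton] at this
  exact (sq_eq_sq₀ (norm_nonneg _) (norm_nonneg _)).1 this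

theorem sum_smul_restrictBlocks_apply (A : Finset (Fin l)) (c : Fin l → ℝ) (x : Signal d)
    (p : Σ i : Fin l, Fin (d i)) :
    (∑ i ∈ A, c i • restrictBlocks {i} x) p = if p.1 ∈ A then c p.1 * x p else 0 := by
  simp [restrictBlocks]

theorem sum_restrictBlocks_singleton (x : Signal d) : ∑ i, restrictBlocks {i} x = x := by
  ext p
  simpa using sum_smul_restrictBlocks_apply univ (fun _ => 1) x p

theorem pairwise_inner_restrictBlocks (x : Signal d) :
    Pairwise fun i j => inner ℝ (restrictBlocks {i} x) (restrictBlocks {j} x) = 0 := by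
  intro i j hij
  rw [PiLp.inner_apply]
  refine sum_eq_zero fun p _ => ?_
  by_cases h : p.1 = i
  · have : p.1 ≠ j := h ▸ hij
    simp [restrictBlocks, this]
  · simp [restrictBlocks, h]

theorem isBlockSparse_sum_smul (A : Finset (Fin l)) (c : Fin l → ℝ) (x : Signal d) :
    IsBlockSparse A.card (∑ i ∈ A, c i • restrictBlocks {i} x) := by
  refine card_le_card fun i hi => ?_
  by_contra hiA
  refine (mem_filter.1 hi).2 ?_
  ext j
  simpa [block, hiA] using sum_smul_restrictBlocks_apply A c x ⟨i, j⟩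

theorem BlockRIP.restrictedIsometry {Φ : Matrix (Fin M) (Σ i : Fin l, Fin (d i)) ℝ} {k : ℕ}
    {δ : ℝ} (h : BlockRIP Φ k δ) (x : Signal d) :
    RestrictedIsometry (Matrix.toEuclideanLin Φ) (fun i => restrictBlocks {i} x) k δ :=
  fun A c hA => h _ ((isBlockSparse_sum_smul A c x).trans hA)

theorem mixedNorm_sub_restrictBlocks (S : Finset (Fin l)) (x : Signal d) :
    mixedNorm (x - restrictBlocks S x) = ∑ i ∈ Sᶜ, ‖block x i‖ := by
  rw [mixedNorm, ← sum_add_sum_compl S, sum_eq_zero (s := S), zero_add]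
  · refine sum_congr rfl fun i hi => congrArg _ ?_
    ext j
    simp [block, restrictBlocks, mem_compl.1 hi]
  · intro i hi
    rw [norm_eq_zero]
    ext j
    simp [block, restrictBlocks, hi]

theorem block_sub (x y : Signal d) (i : Fin l) : block (x - y) i = block x i - block y i := rfl

/-- The cone condition satisfied by the error of a vector of smaller mixed norm. -/
theorem sum_compl_le_of_mixedNorm_le {x z : Signal d} (h : mixedNorm z ≤ mixedNorm x)
    (S : Finset (Fin l)) :
    ∑ i ∈ Sᶜ, ‖block (z - x) i‖ ≤
      ∑ i ∈ S, ‖block (z - x) i‖ + 2 * mixedNorm (x - restrictBlocks S x) := by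
  rw [mixedNorm_sub_restrictBlocks]
  rw [mixedNorm, mixedNorm, ← sum_add_sum_compl S, ← sum_add_sum_compl S fun i => ‖block x i‖] at h
  have h1 : ∑ i ∈ S, ‖block x i‖ ≤ ∑ i ∈ S, ‖block (z - x) i‖ + ∑ i ∈ S, ‖block z i‖ := by
    rw [← sum_add_distrib]
    refine sum_le_sum fun i _ => ?_
    rw [block_sub, norm_sub_rev]
    linarith [norm_sub_norm_le (block x i) (block z i)]
  have h2 : ∑ i ∈ Sᶜ, ‖block (z - x) i‖ ≤ ∑ i ∈ Sᶜ, ‖block z i‖ + ∑ i ∈ Sᶜ, ‖block x i‖ := by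
    rw [← sum_add_distrib]
    exact sum_le_sum fun i _ => norm_sub_le (block z i) (block x i)
  linarith

end BlockSparse

/-! ### The error bound -/

open BlockSparse in
theorem theorem1p1 {l M : ℕ} (d : Fin l → ℕ)
    (Φ : Matrix (Fin M) (Σ i : Fin l, Fin (d i)) ℝ)
    (t : ℝ) (s : ℕ) (ht : 0 < t) (ht' : t < 4 / 3) (hts : 2 ≤ t * s)
    (hδ : blockRIC Φ (t * s) < t / (4 - t))
    (x : Signal d) (ξ b : EuclideanSpace ℝ (Fin M)) (ρ : ℝ)
    (hb : b = apply Φ x + ξ) (hξ : ‖ξ‖ ≤ ρ)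
    (S : Finset (Fin l)) (hS : IsLargestBlocks s x S)
    (xstar : Signal d) (hxstar : IsSolution Φ b ρ xstar) :
    ‖xstar - x‖ ≤
      2 * √2 * ρ * √(1 + blockRIC Φ (t * s)) / (t + (t - 4) * blockRIC Φ (t * s)) * max (√t) t
      + 1 / 2 * √(2 / s) *
        ((8 * blockRIC Φ (t * s)
            + 4 * √((t + (t - 4) * blockRIC Φ (t * s)) * blockRIC Φ (t * s)))
          / (t + (t - 4) * blockRIC Φ (t * s)) + 1)
        * mixedNorm (x - restrictBlocks S x) := by
  obtain ⟨hδ0, hrip⟩ := (isLeast_blockRIC Φ (t * s)).1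
  have hs : 2 ≤ s := by
    have : (1 : ℝ) < s := by nlinarith
    exact_mod_cast this
  obtain ⟨T, hTcard, hT⟩ := exists_isLargestBlocks s (xstar - x)
  have hfeas : ‖apply Φ x - b‖ ≤ ρ := by
    rw [hb, sub_add_cancel_left, norm_neg]
    exact hξ
  -- The cone condition comes for the largest blocks `S` of `x`. Passing to the largest blocks `T`
  -- of the error only raises the head sum and lowers the tail sum.
  have hcone := sum_compl_le_of_mixedNorm_le (hxstar.2 x hfeas) S
  have hST := sum_le_sum_of_card_eq_of_largest (f := fun i => ‖block (xstar - x) i‖)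
    (hS.1.trans hTcard.symm) hT
  have htotS := sum_add_sum_compl S fun i => ‖block (xstar - x) i‖
  have htotT := sum_add_sum_compl T fun i => ‖block (xstar - x) i‖
  have hω : 0 ≤ mixedNorm (x - restrictBlocks S x) := sum_nonneg fun i _ => norm_nonneg _
  have hnoise : ‖Matrix.toEuclideanLin Φ (xstar - x)‖ ≤ 2 * ρ := by
    have : Matrix.toEuclideanLin Φ (xstar - x) = (apply Φ xstar - b) - (apply Φ x - b) := by
      rw [map_sub, sub_sub_sub_cancel_right]
      rfl
    rw [this]
    linarith [norm_sub_le (apply Φ xstar - b) (apply Φ x - b), hxstar.1]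
  have := (hrip.restrictedIsometry (xstar - x)).norm_le_of_cone hδ0
    (pairwise_inner_restrictBlocks _) hs (s := s) (t := t) (T := T)
    (ω := mixedNorm (x - restrictBlocks S x)) (ρ := ρ)
    (by
      have := hts.trans (Nat.le_ceil (t * s))
      exact_mod_cast this)
    (Nat.ceil_le.2 (by push_cast; nlinarith [Nat.cast_nonneg (α := ℝ) s])) ht ht'.le (Nat.le_ceil _)
    hδ (by rw [hTcard, Fintype.card_fin])
    (by simpa only [norm_restrictBlocks_singleton] using hT) hω
    (by simp only [norm_restrictBlocks_singleton]; linarith)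
    (by rw [sum_restrictBlocks_singleton]; exact hnoise)
  rwa [sum_restrictBlocks_singleton] at this
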